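/- **Definitions.** Fix a field $\Bbbk$. Let $K$ be a finite abstract simplicial complex. A *filter function* on $K$ is a function $f:K\to\mathbb R$ with $f(\sigma)\le f(\sigma')$ whenever $\sigma\subseteq\sigma'$; then $K^t=\{\sigma\in K: f(\sigma)\le t\}$ is a subcomplex for every $t\in\mathbb R$. For $p\in\mathbb N$ let $\mathbf H_p(f)$ be the persistence module (functor from $(\mathbb R,\le)$ to $\Bbbk$-vector spaces) $t\mapsto H_p(K^t;\Bbbk)$ (simplicial homology), with the maps induced by inclusions. A *barcode* is a multiset $B\cup\Delta^\infty$, where $B$ is a finite multiset of points of $\mathbb R\times(\mathbb R\cup\{+\infty\})$ and $\Delta^\infty$ consists of countably many copies of the diagonal $\{(b,b):b\in\mathbb R\}$; $Bar$ is the set of barcodes. If $\mathbf H_p(f)\cong\bigoplus_{J\in\mathcal J}\mathbb I_J$ for a finite multiset $\mathcal J$ of nonempty intervals of $\mathbb R$ bounded below, where $\mathbb I_J$ is the interval module of $J$, then $\mathrm{Dgm}_p(f)=\{(\inf J,\sup J)\}_{J\in\mathcal J}\cup\Delta^\infty$. For $m,n\in\mathbb N$ let $Q_{m,n}:\mathbb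 R^{2m}\times\mathbb R^n\to Bar$ be the map $$(b_1,d_1,\dots,b_m,d_m,v_1,\dots,v_n)\mapsto\{(b_i,d_i)\}_{i=1}^m\cup\{(v_j,+\infty)\}_{j=1}^n\cup\Delta^\infty .$$ Let $M$ be a smooth finite-dimensional manifold without boundary and $r\in\mathbb N\cup\{+\infty\}$. A map $B:M\to Bar$ is *$r$-differentiable at $x\in M$* if there are an open neighborhood $W$ of $x$, integers $m,n\in\mathbb N$ and a map $\tilde B:W\to\mathbb R^{2m}\times\mathbb R^n$ of class $C^r$ with $B=Q_{m,n}\circ\tilde B$ on $W$. Two filter functions $f,g$ on $K$ are *ordering equivalent*, $f\sim g$, if they induce the same pre-order on the simplices: $f(\sigma)\le f(\sigma')\iff g(\sigma)\le g(\sigma')$ for all $\sigma,\sigma'\in K$. **Theorem (Global discrete smoothness).** Let $F:M\to\mathbb R^K$ be a continuous map such that $F(x)$ is a filter function for every $x\in M$, let $U\subseteq M$ be open, let $r\in\mathbb N\cup\{+\infty\}$, and suppose that $F$ is of class $C^r$ on $U$. Let $p\in\mathbb N$. Then $\mathrm{Dgm}_p(F(x))$ exists and is unique for every $x\in M$; let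 $B_p:M\to Bar$, $B_p(x)=\mathrm{Dgm}_p(F(x))$. Put $$\tilde M=\{x\in M:\ \text{there is an open neighborhood } U_x \text{ of } x \text{ with } F(x')\sim F(x)\text{ for all }x'\in U_x\}.$$ Then $\tilde M$ is open and dense in $M$, and $B_p$ is $r$-differentiable at every point of $U\cap\tilde M$. In particular, if $U$ is moreover dense in $M$, then there is an open dense subset $G\subseteq U$ of $M$ such that $B_p$ is $r$-differentiable at every point of $G$. -/

import Mathlib

open CategoryTheory Set Topology
open scoped Manifold ContDiff

universe u v w

set_option maxSynthPendingDepth 3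

namespace BarcodeSmoothness

noncomputable section

/-! ### Persistence modules and interval decompositions -/

/-- A persistence module over the field `k`: a functor from the poset `(ℝ, ≤)` to `k`-vector
spaces. -/
abbrev PersistenceModule (k : Type u) [Field k] := ℝ ⥤ ModuleCat.{w} k

/-- A (nonempty, possibly unbounded, open, closed or half-open) interval of the real line. -/
structure RealInterval where
  carrier : Set ℝ
  nonempty : carrier.Nonempty
  ordConnected : carrier.OrdConnected

/-- The space at `t` of the interval module of `J`: a copy of `k` if `t ∈ J`, and `0` otherwise. -/
def intervalSpace (k : Type u) [Field k] (J : RealInterval) (t : ℝ) :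
    Submodule k (ULift.{w} k) :=
  open Classical in if t ∈ J.carrier then ⊤ else ⊥

/-- The structure map of the interval module of `J` into its space at `t`: the identity on the
copies of `k` if `t ∈ J`, and `0` otherwise. -/
def intervalMap (k : Type u) [Field k] (J : RealInterval) (s t : ℝ) :
    intervalSpace.{u, w} k J s →ₗ[k] intervalSpace.{u, w} k J t :=
  LinearMap.restrict (open Classical in if t ∈ J.carrier then LinearMap.id else 0) (by
    intro c _
    by_cases ht : t ∈ J.carrier <;> simp [intervalSpace, ht])

/-- The interval module of `J`. -/
def intervalModule (k : Type u) [Field k] (J : RealInterval) :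
    PersistenceModule.{u, max u w} k where
  obj t := ModuleCat.of k (intervalSpace.{u, w} k J t)
  map {s t} _ := ModuleCat.ofHom (intervalMap.{u, w} k J s t)
  map_id t := by
    ext ⟨c, hc⟩
    by_cases ht : t ∈ J.carrier
    · simp [intervalMap, ht]
    · simp only [intervalSpace, ht, if_false, Submodule.mem_bot] at hc
      simp [intervalMap, ht, hc]
  map_comp {q s t} f g := by
    ext ⟨c, hc⟩
    by_cases hq : q ∈ J.carrier
    · by_cases ht : t ∈ J.carrier
      · have hs : s ∈ J.carrier := J.ordConnected.out hq ht ⟨leOfHom f, leOfHom g⟩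
        simp [intervalMap, ht, hs]
      · simp [intervalMap, ht]
    · simp only [intervalSpace, hq, if_false, Submodule.mem_bot] at hc
      simp [intervalMap, hc]

/-- The direct sum of a finite family of persistence modules, computed pointwise. -/
def directSum {k : Type u} [Field k] {n : ℕ} (W : Fin n → PersistenceModule.{u, w} k) :
    PersistenceModule.{u, w} k where
  obj t := ModuleCat.of k (∀ i, (W i).obj t)
  map f := ModuleCat.ofHom (LinearMap.pi fun i => ((W i).map f).hom ∘ₗ LinearMap.proj i)
  map_id t := by ext x; simp
  map_comp f g := by ext x; simp

/-! ### Persistence diagrams -/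

/-- The multiplicity function of the multiset `B ∪ Δ^∞`, where `Δ^∞` consists of countably many
copies of the diagonal. -/
def withDiagonal (B : Multiset (ℝ × WithTop ℝ)) (x : ℝ × WithTop ℝ) : ℕ∞ :=
  open Classical in (B.count x : ℕ∞) + if x.2 = (x.1 : WithTop ℝ) then ⊤ else 0

/-- The set of persistence diagrams (barcodes): multisets of the form `B ∪ Δ^∞`, where `B` is a
finite multiset of points of `ℝ × (ℝ ∪ {+∞})`. -/
def Bar : Type :=
  {D : ℝ × WithTop ℝ → ℕ∞ // ∃ B : Multiset (ℝ × WithTop ℝ), D = withDiagonal B}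

/-- The persistence diagram `B ∪ Δ^∞`. -/
def Bar.ofMultiset (B : Multiset (ℝ × WithTop ℝ)) : Bar := ⟨withDiagonal B, B, rfl⟩

/-- The point `(inf J, sup J)` (for `J` bounded below). -/
def RealInterval.endpoints (J : RealInterval) : ℝ × WithTop ℝ :=
  open Classical in
  (sInf J.carrier, if BddAbove J.carrier then ((sSup J.carrier : ℝ) : WithTop ℝ) else ⊤)

/-- `D` is the persistence diagram of `𝕍`: the module `𝕍` is isomorphic to a finite direct sum of
interval modules, and `D` is the multiset of the pairs of endpoints of these intervals, together
with `Δ^∞`. -/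
def IsDiagramOf {k : Type u} [Field k] (𝕍 : PersistenceModule.{u, max u w} k) (D : Bar) : Prop :=
  ∃ (n : ℕ) (J : Fin n → RealInterval),
    (∀ i, BddBelow (J i).carrier) ∧
    Nonempty (𝕍 ≅ directSum fun i => intervalModule.{u, w} k (J i)) ∧
    D = Bar.ofMultiset (Finset.univ.val.map fun i => (J i).endpoints)

/-! ### Simplicial homology with coefficients in a field

The vertices are totally ordered, and a `p`-simplex is written as the strictly increasing tuple of
its `p + 1` vertices. -/

section Homology

variable (k : Type u) [Field k] {V : Type v}

/-- The simplicial boundary in positive degrees: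
`[v₀, …, v_{p+1}] ↦ ∑ i, (-1)^i [v₀, …, v̂ᵢ, …, v_{p+1}]`. -/
def boundary (V : Type v) (p : ℕ) :
    ((Fin (p + 2) → V) →₀ k) →ₗ[k] ((Fin (p + 1) → V) →₀ k) :=
  ∑ i : Fin (p + 2), (-1 : k) ^ (i : ℕ) • Finsupp.lmapDomain k k fun v => v ∘ i.succAbove

theorem boundary_single (p : ℕ) (v : Fin (p + 2) → V) (a : k) :
    boundary k V p (Finsupp.single v a) =
      ∑ i : Fin (p + 2), (-1 : k) ^ (i : ℕ) • Finsupp.single (v ∘ i.succAbove) a := by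
  simp [boundary, LinearMap.sum_apply, Finsupp.mapDomain_single]

theorem boundary_boundary (p : ℕ) (c : (Fin (p + 3) → V) →₀ k) :
    boundary k V p (boundary k V (p + 1) c) = 0 := by
  induction c using Finsupp.induction_linear with
  | zero => simp
  | add c d hc hd => simp [hc, hd]
  | single v a =>
    simp only [boundary_single, map_sum, map_smul, Finset.smul_sum, smul_smul, ← pow_add]
    rw [← Finset.sum_product', Finset.univ_product_univ]
    refine Finset.sum_involution (fun ij _ => (ij.1.succAbove ij.2, ij.2.predAbove ij.1))
      ?_ ?_ ?_ ?_
    · rintro ⟨i, j⟩ -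
      have hpow : (-1 : k) ^ ((i.succAbove j : Fin (p + 3)) + (j.predAbove i : Fin (p + 2)) : ℕ) =
          -(-1 : k) ^ ((i : ℕ) + j) := by
        rcases lt_or_ge j.castSucc i with h | h
        · rw [Fin.succAbove_of_castSucc_lt _ _ h, Fin.predAbove_of_castSucc_lt _ _ h]
          obtain ⟨m, hm⟩ : ∃ m, (i : ℕ) = m + 1 :=
            ⟨i - 1, by have : (j : ℕ) < i := h; omega⟩
          simp only [Fin.val_castSucc, Fin.val_pred, hm, Nat.add_sub_cancel]
          ring
        · rw [Fin.succAbove_of_le_castSucc _ _ h, Fin.predAbove_of_le_castSucc _ _ h]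
          simp only [Fin.val_succ, Fin.coe_castPred]
          ring
      have hcomp : (v ∘ (i.succAbove j).succAbove) ∘ (j.predAbove i).succAbove =
          (v ∘ i.succAbove) ∘ j.succAbove := by
        funext l
        simp only [Function.comp]
        rw [Fin.succAbove_succAbove_succAbove_predAbove]
      simp only [hpow, hcomp, neg_smul, add_neg_cancel]
    · rintro ⟨i, j⟩ - - h
      exact Fin.succAbove_ne i j (congrArg Prod.fst h)
    · intros; exact Finset.mem_univ _
    · rintro ⟨i, j⟩ -
      simp [Fin.succAbove_succAbove_predAbove, Fin.predAbove_predAbove_succAbove]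

variable [LinearOrder V]

/-- The simplicial `p`-chains of `K`: the span of the `p`-simplices of `K`, inside the free vector
space on all `(p + 1)`-tuples of vertices. -/
def chains (K : PreAbstractSimplicialComplex V) (p : ℕ) : Submodule k ((Fin (p + 1) → V) →₀ k) :=
  Submodule.span k
    {c | ∃ v : Fin (p + 1) → V, StrictMono v ∧ Finset.univ.image v ∈ K.faces ∧
      c = Finsupp.single v 1}

/-- The simplicial `p`-cycles of `K`; every `0`-chain is a cycle. -/
def cycles (K : PreAbstractSimplicialComplex V) : ∀ p : ℕ, Submodule k ((Fin (p + 1) → V) →₀ k)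
  | 0 => chains k K 0
  | p + 1 => chains k K (p + 1) ⊓ LinearMap.ker (boundary k V p)

/-- The simplicial `p`-boundaries of `K`. -/
def boundaries (K : PreAbstractSimplicialComplex V) (p : ℕ) :
    Submodule k ((Fin (p + 1) → V) →₀ k) :=
  (chains k K (p + 1)).map (boundary k V p)

/-- The simplicial homology of `K` in degree `p`: cycles modulo boundaries. -/
abbrev homology (K : PreAbstractSimplicialComplex V) (p : ℕ) : Type (max u v) :=
  cycles k K p ⧸ (boundaries k K p).comap (cycles k K p).subtype

theorem boundary_mem_chains {K : PreAbstractSimplicialComplex V} {p : ℕ}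
    {c : (Fin (p + 2) → V) →₀ k} (hc : c ∈ chains k K (p + 1)) :
    boundary k V p c ∈ chains k K p := by
  suffices h : chains k K (p + 1) ≤ (chains k K p).comap (boundary k V p) from h hc
  refine Submodule.span_le.2 ?_
  rintro _ ⟨v, hv, hvK, rfl⟩
  simp only [Submodule.comap_coe, Set.mem_preimage, SetLike.mem_coe, boundary_single]
  refine Submodule.sum_mem _ fun i _ => Submodule.smul_mem _ _ (Submodule.subset_span ?_)
  refine ⟨_, hv.comp i.strictMono_succAbove, ?_, rfl⟩
  refine (K.isRelLowerSet_faces hvK).2 ?_ (Finset.univ_nonempty.image _)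
  intro x hx
  simp only [Finset.mem_image, Finset.mem_univ, true_and, Function.comp] at hx ⊢
  obtain ⟨j, rfl⟩ := hx
  exact ⟨_, rfl⟩

/-- Boundaries are cycles. -/
theorem boundaries_le_cycles (K : PreAbstractSimplicialComplex V) (p : ℕ) :
    boundaries k K p ≤ cycles k K p := by
  rintro _ ⟨c, hc, rfl⟩
  cases p with
  | zero => exact boundary_mem_chains k hc
  | succ p => exact ⟨boundary_mem_chains k hc, boundary_boundary k p c⟩

variable {K L : PreAbstractSimplicialComplex V}

theorem chains_mono (h : K ≤ L) (p : ℕ) : chains k K p ≤ chains k L p :=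
  Submodule.span_mono fun _ ⟨v, hv, hvK, hc⟩ => ⟨v, hv, h hvK, hc⟩

theorem cycles_mono (h : K ≤ L) (p : ℕ) : cycles k K p ≤ cycles k L p := by
  cases p with
  | zero => exact chains_mono k h 0
  | succ p => exact inf_le_inf_right _ (chains_mono k h (p + 1))

theorem boundaries_mono (h : K ≤ L) (p : ℕ) : boundaries k K p ≤ boundaries k L p :=
  Submodule.map_mono (chains_mono k h (p + 1))

/-- The map induced in homology by the inclusion of a subcomplex `K` into `L`. -/
def homologyMap (h : K ≤ L) (p : ℕ) : homology k K p →ₗ[k] homology k L p :=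
  Submodule.mapQ _ _ (Submodule.inclusion (cycles_mono k h p)) fun _ hz =>
    boundaries_mono k h p hz

end Homology

/-! ### Filter functions and their persistence diagrams -/

section Filter

variable {V : Type v} {K : PreAbstractSimplicialComplex V}

/-- A filter function on `K`: a real function on the simplices of `K` that is monotone with respect
to inclusions of faces. -/
def IsFilterFunction (f : K.faces → ℝ) : Prop :=
  ∀ σ τ : K.faces, (σ : Finset V) ⊆ τ → f σ ≤ f τ

/-- The sublevel complex `K^t` of a filter function `f`, whose simplices are the simplices `σ` of
`K` with `f σ ≤ t`. -/
def sublevel (f : K.faces → ℝ) (hf : IsFilterFunction f) (t : ℝ) :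
    PreAbstractSimplicialComplex V where
  faces := {σ | ∃ h : σ ∈ K.faces, f ⟨σ, h⟩ ≤ t}
  isRelLowerSet_faces := by
    rintro σ ⟨hσ, hσt⟩
    refine ⟨(K.isRelLowerSet_faces hσ).1, fun τ hτσ hτ => ?_⟩
    have hτK : τ ∈ K.faces := (K.isRelLowerSet_faces hσ).2 hτσ hτ
    exact ⟨hτK, (hf ⟨τ, hτK⟩ ⟨σ, hσ⟩ hτσ).trans hσt⟩

theorem sublevel_mono (f : K.faces → ℝ) (hf : IsFilterFunction f) {s t : ℝ} (h : s ≤ t) :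
    sublevel f hf s ≤ sublevel f hf t :=
  fun _ ⟨hσ, hσs⟩ => ⟨hσ, hσs.trans h⟩

/-- The persistent homology module `H_p(f)` of a filter function `f`: the homology spaces
`H_p(K^t)`, with the maps induced by the inclusions `K^s ⊆ K^t`. -/
def persistentHomology (k : Type u) [Field k] [LinearOrder V] (f : K.faces → ℝ) (hf : IsFilterFunction f)
    (p : ℕ) : PersistenceModule.{u, max u v} k where
  obj t := ModuleCat.of k (homology k (sublevel f hf t) p)
  map g := ModuleCat.ofHom (homologyMap k (sublevel_mono f hf (leOfHom g)) p)
  map_id t := by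
    ext x
    rfl
  map_comp f g := by
    ext x
    rfl

/-- `D` is the persistence diagram in degree `p` of the filter function `f`. -/
def IsDgm (k : Type u) [Field k] [LinearOrder V] (f : K.faces → ℝ) (hf : IsFilterFunction f) (p : ℕ)
    (D : Bar) : Prop :=
  IsDiagramOf.{u, v} (persistentHomology k f hf p) D

/-- The persistence diagram `Dgm_p(f)` of a filter function `f`. -/
def Dgm (k : Type u) [Field k] [LinearOrder V] (f : K.faces → ℝ) (hf : IsFilterFunction f) (p : ℕ) : Bar :=
  open Classical in
  if h : ∃ D, IsDgm k f hf p D then h.choose else Bar.ofMultiset 0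

/-- Ordering equivalence `f ∼ g`: both functions induce the same pre-order on the simplices. -/
def OrderingEquivalent (f g : K.faces → ℝ) : Prop :=
  ∀ σ τ : K.faces, f σ ≤ f τ ↔ g σ ≤ g τ

/-- The set of the parameters around which the pre-order induced on the simplices is locally
constant. -/
def locallyConstantOrder {M : Type*} [TopologicalSpace M] (F : M → K.faces → ℝ) : Set M :=
  {x | ∃ W : Set M, IsOpen W ∧ x ∈ W ∧ ∀ y ∈ W, OrderingEquivalent (F y) (F x)}

end Filter

/-! ### Differentiability of barcode valued maps -/

/-- The space `ℝ^{2m} × ℝ^n` of ordered barcodes; the coordinates `(i, 0)` and `(i, 1)` of the first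
component are the two endpoints of the `i`-th finite bar. -/
abbrev OrderedBarcode (m n : ℕ) :=
  EuclideanSpace ℝ (Fin m × Fin 2) × EuclideanSpace ℝ (Fin n)

/-- The quotient map
`(b, d, v) ↦ {(bᵢ, dᵢ)}ᵢ ∪ {(vⱼ, +∞)}ⱼ ∪ Δ^∞` from ordered barcodes to barcodes. -/
def quotientMap (m n : ℕ) (x : OrderedBarcode m n) : Bar :=
  Bar.ofMultiset
    ((Finset.univ.val.map fun i : Fin m => (x.1 (i, 0), ((x.1 (i, 1) : ℝ) : WithTop ℝ))) +
      (Finset.univ.val.map fun j : Fin n => (x.2 j, (⊤ : WithTop ℝ))))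

/-- A barcode valued map `B` on a manifold is `r`-differentiable at `x` if it has a lift of class
`C^r` to a space of ordered barcodes, on an open neighborhood of `x`. -/
def RDifferentiableAt {E : Type*} [NormedAddCommGroup E] [NormedSpace ℝ E]
    {M : Type*} [TopologicalSpace M] [ChartedSpace E M]
    (r : ℕ∞) (B : M → Bar) (x : M) : Prop :=
  ∃ W : Set M, IsOpen W ∧ x ∈ W ∧ ∃ (m n : ℕ) (L : M → OrderedBarcode m n),
    ContMDiffOn 𝓘(ℝ, E) 𝓘(ℝ, OrderedBarcode m n) r L W ∧
    ∀ y ∈ W, B y = quotientMap m n (L y)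

end

end BarcodeSmoothness

/-!
Fix a filter function `f`. The cycles and the boundaries of its sublevel complexes form two chains
of subspaces of a finite dimensional space of chains, and two chains of subspaces always have a
common adapted family: independent vectors such that each subspace is spanned by those it contains.
The classes of the adapted vectors split the persistent homology of `f` into interval modules, a
vector being alive from the moment it becomes a cycle until it becomes a boundary.

Whether a vector is a cycle or a boundary of a sublevel complex depends on that complex only. Hence
each of the two moments is the value of `f` at a simplex which is the same for all filter functions
inducing the same preorder. Where the preorder induced by `F x` is locally constant, the diagram is
therefore read off linearly from `F x`, and it is as differentiable as `F`. The preorder is locally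
constant away from the frontiers of the finitely many closed sets `{x | F x σ ≤ F x τ}`, which have
empty interior.

The diagram is unique because the rank of the structure map from `s` to `t` counts the intervals
containing `s` and `t`. For every nonempty open set, these ranks determine the number of intervals
containing it, and these numbers determine the multiset of the nonempty interiors of the intervals.
-/

namespace BarcodeSmoothness

section Flags

variable {k W ι : Type*} [DivisionRing k] [AddCommGroup W] [Module k W]

/-- The family `e` is adapted to the subspace `A`: its members that lie in `A` span `A`. Adapted to
all members of a filtration, `e` records at which step each of its members enters. -/
def IsAdapted (e : ι → W) (A : Submodule k W) : Prop :=
  A ≤ Submodule.span k (e '' {i | e i ∈ A})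

theorem exists_linearForm_of_isChain {S : Set (Submodule k W)} (hS : IsChain (· ≤ ·) S)
    {H : Submodule k W} (hH : H.FG) (hbot : H ≠ ⊥) :
    ∃ ψ : W →ₗ[k] k, (∃ x ∈ H, ψ x ≠ 0) ∧ ∀ A ∈ S, H ≤ A ∨ A ≤ LinearMap.ker ψ := by
  let S' : Set (Submodule k W) := {A ∈ S | ¬ H ≤ A}
  have hN : ¬ H ≤ sSup S' := by
    intro h
    rcases S'.eq_empty_or_nonempty with hemp | hne
    · exact hbot (by simpa [hemp] using h)
    · obtain ⟨A, hA, hHA⟩ := (CompleteLattice.isCompactElement_iff_le_of_directed_sSup_le _ H).1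
        ((Submodule.fg_iff_compact H).1 hH) S' hne (hS.mono (sep_subset _ _)).directedOn h
      exact hA.2 hHA
  obtain ⟨x, hxH, hxN⟩ := SetLike.not_le_iff_exists.1 hN
  obtain ⟨ψ, hψ, hker⟩ := Submodule.exists_le_ker_of_notMem hxN
  refine ⟨ψ, ⟨x, hxH, hψ⟩, fun A hA => or_iff_not_imp_left.2 fun h => ?_⟩
  exact (le_sSup (show A ∈ S' from ⟨hA, h⟩)).trans hker

theorem exists_mem_of_isChain {T : Set (Submodule k W)} (hT : IsChain (· ≤ ·) T)
    {H : Submodule k W} [FiniteDimensional k H] {ψ : W →ₗ[k] k} (hψ : ∃ x ∈ H, ψ x ≠ 0) :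
    ∃ v ∈ H, ψ v ≠ 0 ∧ ∀ A ∈ T, A ⊓ H ≤ LinearMap.ker ψ ∨ v ∈ A := by
  by_cases hex : ∃ A ∈ T, ¬ A ⊓ H ≤ LinearMap.ker ψ
  · obtain ⟨A, ⟨hAT, hA⟩, hmin⟩ := exists_minimalFor_of_wellFoundedLT
      (fun A => A ∈ T ∧ ¬ A ⊓ H ≤ LinearMap.ker ψ) (·.comap H.subtype) hex
    obtain ⟨v, hv, hvψ⟩ := SetLike.not_le_iff_exists.1 hA
    refine ⟨v, hv.2, hvψ, fun B hB => or_iff_not_imp_left.2 fun hBψ => ?_⟩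
    rcases hT.total hAT hB with h | h
    · exact h hv.1
    · exact hmin ⟨hB, hBψ⟩ (Submodule.comap_mono h) (x := ⟨v, hv.2⟩) hv.1
  · push Not at hex
    obtain ⟨x, hxH, hx⟩ := hψ
    exact ⟨x, hxH, hx, fun A hA => Or.inl (hex A hA)⟩

theorem IsAdapted.cons {A H : Submodule k W} {ψ : W →ₗ[k] k} {n : ℕ} {e : Fin n → W} {v : W}
    (he : IsAdapted e (A ⊓ (H ⊓ LinearMap.ker ψ))) (hvH : v ∈ H) (hv : ψ v ≠ 0)
    (hA : A ⊓ H ≤ LinearMap.ker ψ ∨ v ∈ A) :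
    IsAdapted (Fin.cons v e : Fin (n + 1) → W) (A ⊓ H) := by
  set e' : Fin (n + 1) → W := Fin.cons v e
  have hle : A ⊓ (H ⊓ LinearMap.ker ψ) ≤ Submodule.span k (e' '' {i | e' i ∈ A ⊓ H}) := by
    refine he.trans (Submodule.span_mono ?_)
    rintro _ ⟨i, hi, rfl⟩
    exact ⟨i.succ, ⟨hi.1, hi.2.1⟩, rfl⟩
  rintro y ⟨hyA, hyH⟩
  rcases hA with hA | hvA
  · exact hle ⟨hyA, hyH, hA ⟨hyA, hyH⟩⟩
  · have hmem : y - (ψ y / ψ v) • v ∈ A ⊓ (H ⊓ LinearMap.ker ψ) :=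
      ⟨A.sub_mem hyA (A.smul_mem _ hvA), H.sub_mem hyH (H.smul_mem _ hvH), by simp [hv]⟩
    rw [← sub_add_cancel y ((ψ y / ψ v) • v)]
    exact add_mem (hle hmem)
      (Submodule.smul_mem _ _ (Submodule.subset_span ⟨0, ⟨hvA, hvH⟩, rfl⟩))

theorem exists_linearIndependent_isAdapted_inf {S T : Set (Submodule k W)}
    (hS : IsChain (· ≤ ·) S) (hT : IsChain (· ≤ ·) T) (H : Submodule k W)
    [FiniteDimensional k H] :
    ∃ (n : ℕ) (e : Fin n → W), LinearIndependent k e ∧ (∀ i, e i ∈ H) ∧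
      ∀ A ∈ S ∪ T, IsAdapted e (A ⊓ H) := by
  induction hd : Module.finrank k H using Nat.strong_induction_on generalizing H with
  | _ d ih =>
  by_cases hH : H = ⊥
  · exact ⟨0, Fin.elim0, linearIndependent_empty_type, finZeroElim,
      fun A _ => by simp [IsAdapted, hH]⟩
  obtain ⟨ψ, ⟨x, hxH, hx⟩, hSψ⟩ := exists_linearForm_of_isChain hS (Module.Finite.iff_fg.1 ‹_›) hH
  obtain ⟨v, hvH, hv, hTv⟩ := exists_mem_of_isChain hT ⟨x, hxH, hx⟩
  have hlt : H ⊓ LinearMap.ker ψ < H := inf_lt_left.2 fun h => hx (h hxH)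
  have hfd : FiniteDimensional k (H ⊓ LinearMap.ker ψ : Submodule k W) :=
    Submodule.finiteDimensional_of_le inf_le_left
  obtain ⟨n, e, hli, heH, he⟩ := ih _ (hd ▸ Submodule.finrank_lt_finrank_of_lt hlt) _ rfl
  have hspan : Submodule.span k (range e) ≤ H ⊓ LinearMap.ker ψ :=
    Submodule.span_le.2 (range_subset_iff.2 heH)
  refine ⟨n + 1, Fin.cons v e, linearIndependent_finCons.2 ⟨hli, fun h => hv (hspan h).2⟩,
    Fin.cases hvH fun i => (heH i).1, fun A hA => (he A hA).cons hvH hv ?_⟩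
  exact hA.elim (fun hA => (hSψ A hA).symm.imp inf_le_left.trans fun h => h hvH) (hTv A)

theorem exists_linearIndependent_isAdapted {S T : Set (Submodule k W)} (hS : IsChain (· ≤ ·) S)
    (hT : IsChain (· ≤ ·) T) {H : Submodule k W} [FiniteDimensional k H]
    (hH : ∀ A ∈ S ∪ T, A ≤ H) :
    ∃ (n : ℕ) (e : Fin n → W), LinearIndependent k e ∧ ∀ A ∈ S ∪ T, IsAdapted e A := by
  obtain ⟨n, e, hli, -, he⟩ := exists_linearIndependent_isAdapted_inf hS hT H
  exact ⟨n, e, hli, fun A hA => inf_eq_left.2 (hH A hA) ▸ he A hA⟩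

end Flags

section IntervalModules

variable {k : Type u} [Field k]

theorem coe_eq_zero_of_notMem {J : RealInterval} {t : ℝ} (ht : t ∉ J.carrier)
    (y : intervalSpace.{u, w} k J t) : (y : ULift.{w} k) = 0 := by
  obtain ⟨y, hy⟩ := y
  simpa only [intervalSpace, if_neg ht, Submodule.mem_bot] using hy

theorem coe_intervalMap_of_mem {J : RealInterval} {s t : ℝ} (ht : t ∈ J.carrier)
    (y : intervalSpace.{u, w} k J s) :
    (intervalMap.{u, w} k J s t y : ULift.{w} k) = y := by
  simp [intervalMap, ht]

end IntervalModules

section Subquotients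

variable {k : Type u} [Field k] {W : Type w} [AddCommGroup W] [Module k W]

/-- The persistence module `t ↦ Z t / (Z t ∩ B t)` of two increasing families of subspaces. -/
noncomputable def subquotient (Z B : ℝ →o Submodule k W) : PersistenceModule.{u, w} k where
  obj t := ModuleCat.of k (Z t ⧸ (B t).comap (Z t).subtype)
  map {_ _} f := ModuleCat.ofHom (Submodule.mapQ _ _
    (Submodule.inclusion (Z.monotone (leOfHom f))) fun _ hx => B.monotone (leOfHom f) hx)
  map_id t := by
    ext x
    rfl
  map_comp f g := by
    ext x
    rfl

/-- The parameters at which `x` represents a nonzero element of `subquotient Z B`. -/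
def lifetime (Z B : ℝ →o Submodule k W) (x : W) : Set ℝ :=
  {t | x ∈ Z t ∧ x ∉ B t}

/-- A nonempty lifetime as an interval. -/
def lifetimeInterval {Z B : ℝ →o Submodule k W} {x : W} (hx : (lifetime Z B x).Nonempty) :
    RealInterval where
  carrier := lifetime Z B x
  nonempty := hx
  ordConnected := ⟨fun _ hs _ ht _ hr =>
    ⟨Z.monotone hr.1 hs.1, fun h => ht.2 (B.monotone hr.2 h)⟩⟩

end Subquotients

section Decomposition

variable {k : Type u} [Field k] {W : Type max u w} [AddCommGroup W] [Module k W]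
  {Z B : ℝ →o Submodule k W}

theorem smul_mem_of_lifetime {x : W} (hx : (lifetime Z B x).Nonempty) {t : ℝ}
    (y : intervalSpace.{u, w} k (lifetimeInterval hx) t) :
    (y : ULift.{w} k).down • x ∈ Z t := by
  by_cases ht : t ∈ lifetime Z B x
  · exact (Z t).smul_mem _ ht.1
  · simp [coe_eq_zero_of_notMem (J := lifetimeInterval hx) ht]

theorem intervalMap_smul_sub_mem {x : W} (hx : (lifetime Z B x).Nonempty) {s t : ℝ} (hst : s ≤ t)
    (y : intervalSpace.{u, w} k (lifetimeInterval hx) s) :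
    (intervalMap.{u, w} k (lifetimeInterval hx) s t y : ULift.{w} k).down • x -
      (y : ULift.{w} k).down • x ∈ B t := by
  by_cases ht : t ∈ lifetime Z B x
  · simp [coe_intervalMap_of_mem (J := lifetimeInterval hx) ht]
  rw [coe_eq_zero_of_notMem (J := lifetimeInterval hx) ht, ULift.zero_down, zero_smul, zero_sub]
  refine neg_mem ?_
  by_cases hs : s ∈ lifetime Z B x
  · exact (B t).smul_mem _ (not_not.1 fun h => ht ⟨Z.monotone hst hs.1, h⟩)
  · simp [coe_eq_zero_of_notMem (J := lifetimeInterval hx) hs y]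

variable {n : ℕ} {x : Fin n → W} (hx : ∀ a, (lifetime Z B (x a)).Nonempty)

/-- The linear combinations of those vectors among the `x a` that are alive at `t`. -/
noncomputable def lifetimeCombination (t : ℝ) :
    (∀ a, intervalSpace.{u, w} k (lifetimeInterval (hx a)) t) →ₗ[k] Z t :=
  LinearMap.codRestrict (Z t) (∑ a, LinearMap.toSpanSingleton k W (x a) ∘ₗ
    ULift.moduleEquiv.toLinearMap ∘ₗ Submodule.subtype _ ∘ₗ LinearMap.proj a) fun y => by
      rw [LinearMap.sum_apply]
      exact sum_mem fun a _ => smul_mem_of_lifetime (hx a) (y a)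

theorem coe_lifetimeCombination (t : ℝ)
    (y : ∀ a, intervalSpace.{u, w} k (lifetimeInterval (hx a)) t) :
    (lifetimeCombination hx t y : W) = ∑ a, (y a : ULift.{w} k).down • x a :=
  LinearMap.sum_apply _ _ _

/-- The morphism from the sum of the interval modules of the lifetimes of the `x a` that sends the
generators to the classes of the `x a`. -/
noncomputable def lifetimeMap :
    directSum (fun a => intervalModule.{u, w} k (lifetimeInterval (hx a))) ⟶ subquotient Z B where
  app t := ModuleCat.ofHom (((B t).comap (Z t).subtype).mkQ ∘ₗ lifetimeCombination hx t)
  naturality s t f := by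
    refine ModuleCat.hom_ext (LinearMap.ext fun y => (Submodule.Quotient.eq _).2 ?_)
    let y' : ∀ a, intervalSpace.{u, w} k (lifetimeInterval (hx a)) s := y
    change (lifetimeCombination hx t fun a => intervalMap.{u, w} k _ s t (y' a) : W) -
      lifetimeCombination hx s y' ∈ B t
    rw [coe_lifetimeCombination, coe_lifetimeCombination, ← Finset.sum_sub_distrib]
    exact sum_mem fun a _ => intervalMap_smul_sub_mem (hx a) (leOfHom f) (y' a)

variable {ι : Type*} {e : ι → W} {c : Fin n → ι} (hc : ∀ a, (lifetime Z B (e (c a))).Nonempty)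

theorem injective_mkQ_lifetimeCombination (he : LinearIndependent k e)
    (hinj : Function.Injective c) {t : ℝ} (hB : IsAdapted e (B t)) :
    Function.Injective
      (((B t).comap (Z t).subtype).mkQ ∘ₗ lifetimeCombination.{u, w} hc t) := by
  refine (injective_iff_map_eq_zero _).2 fun y hy => ?_
  have hyB : (lifetimeCombination hc t y : W) ∈ B t :=
    (Submodule.Quotient.mk_eq_zero ((B t).comap (Z t).subtype)).1 hy
  rw [coe_lifetimeCombination] at hyB
  have hyJ : ∑ a, (y a : ULift.{w} k).down • e (c a) ∈
      Submodule.span k (e '' {i | t ∈ lifetime Z B (e i)}) := by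
    refine sum_mem fun a _ => ?_
    by_cases ha : t ∈ lifetime Z B (e (c a))
    · exact Submodule.smul_mem _ _ (Submodule.subset_span ⟨c a, ha, rfl⟩)
    · simp [coe_eq_zero_of_notMem (J := lifetimeInterval (hc a)) ha (y a)]
  have hdisj := he.disjoint_span_image (s := {i | e i ∈ B t}) (t := {i | t ∈ lifetime Z B (e i)})
    (Set.disjoint_left.2 fun i hi h => h.2 hi)
  have h0 := Fintype.linearIndependent_iff.1 (he.comp c hinj) _
    (Submodule.disjoint_def.1 hdisj _ (hB hyB) hyJ)
  exact funext fun a => Subtype.ext (ULift.ext _ _ (h0 a))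

theorem surjective_mkQ_lifetimeCombination
    (hsurj : ∀ i, (lifetime Z B (e i)).Nonempty → i ∈ range c) {t : ℝ} (hZ : IsAdapted e (Z t)) :
    Function.Surjective
      (((B t).comap (Z t).subtype).mkQ ∘ₗ lifetimeCombination.{u, w} hc t) := by
  have hle : Z t ≤ (LinearMap.range (lifetimeCombination hc t)).map (Z t).subtype ⊔ B t := by
    refine hZ.trans (Submodule.span_le.2 ?_)
    rintro _ ⟨i, hi, rfl⟩
    by_cases hiB : e i ∈ B t
    · exact Submodule.mem_sup_right hiB
    obtain ⟨a, rfl⟩ := hsurj i ⟨t, hi, hiB⟩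
    have ha : t ∈ (lifetimeInterval (hc a)).carrier := ⟨hi, hiB⟩
    refine Submodule.mem_sup_left ⟨_, ⟨Pi.single a ⟨⟨1⟩, by simp [intervalSpace, ha]⟩, rfl⟩, ?_⟩
    rw [Submodule.subtype_apply, coe_lifetimeCombination,
      Fintype.sum_eq_single a fun b hb => by simp [hb]]
    simp
  intro q
  obtain ⟨⟨z, hz⟩, rfl⟩ := Submodule.mkQ_surjective _ q
  obtain ⟨_, ⟨_, ⟨y, rfl⟩, rfl⟩, b, hb, hyz⟩ := Submodule.mem_sup.1 (hle hz)
  refine ⟨y, (Submodule.Quotient.eq _).2 ?_⟩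
  change (lifetimeCombination hc t y : W) - z ∈ B t
  rw [← hyz, Submodule.subtype_apply, sub_add_cancel_left]
  exact neg_mem hb

theorem isIso_lifetimeMap (he : LinearIndependent k e) (hinj : Function.Injective c)
    (hsurj : ∀ i, (lifetime Z B (e i)).Nonempty → i ∈ range c)
    (hZ : ∀ t, IsAdapted e (Z t)) (hB : ∀ t, IsAdapted e (B t)) :
    IsIso (lifetimeMap.{u, w} hc) := by
  refine (NatTrans.isIso_iff_isIso_app _).2 fun t => (ConcreteCategory.isIso_iff_bijective _).2 ?_
  exact ⟨injective_mkQ_lifetimeCombination hc he hinj (hB t),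
    surjective_mkQ_lifetimeCombination hc hsurj (hZ t)⟩

end Decomposition

section Multisets

open Classical in
theorem multiset_eq_of_countP_le_eq {α : Type*} [PartialOrder α] {X Y : Multiset α}
    (h : ∀ a ∈ X + Y, X.countP (a ≤ ·) = Y.countP (a ≤ ·)) : X = Y := by
  by_contra hne
  have hmem : ∀ a, X.count a ≠ Y.count a → a ∈ X + Y := fun a ha => by
    by_contra haXY
    rw [Multiset.mem_add, not_or] at haXY
    exact ha (by rw [Multiset.count_eq_zero.2 haXY.1, Multiset.count_eq_zero.2 haXY.2])
  have hfin : {a | X.count a ≠ Y.count a}.Finite :=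
    (X + Y).toFinset.finite_toSet.subset fun a ha => Multiset.mem_toFinset.2 (hmem a ha)
  obtain ⟨a, ha, hmax⟩ := hfin.exists_maximal
    (not_forall.1 fun hcount => hne (Multiset.ext.2 hcount))
  have hsplit (Z : Multiset α) : Z.countP (a ≤ ·) = Z.count a + (Z.filter (a < ·)).card := by
    rw [← Multiset.countP_eq_card_filter]
    induction Z using Multiset.induction with
    | empty => rfl
    | cons b Z ih =>
      rw [Multiset.countP_cons, Multiset.countP_cons, Multiset.count_cons, ih]
      by_cases hab : a = b
      · simp only [hab, le_refl, lt_irrefl, if_true, if_false]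
        omega
      · simp only [hab, le_iff_eq_or_lt, if_false, false_or]
        omega
  have hlt : X.filter (a < ·) = Y.filter (a < ·) := by
    refine Multiset.ext.2 fun b => ?_
    by_cases hb : a < b
    · simpa [hb] using not_not.1 fun hb' => hb.not_ge (hmax hb' hb.le)
    · simp [hb]
  have hcount := h a (hmem a ha)
  rw [hsplit, hsplit, hlt] at hcount
  exact ha (Nat.add_right_cancel hcount)

end Multisets

section Ranks

theorem finrank_range_pi {k ι : Type*} [DivisionRing k] [Fintype ι] {X Y : ι → Type*}
    [∀ i, AddCommGroup (X i)] [∀ i, Module k (X i)] [∀ i, AddCommGroup (Y i)] [∀ i, Module k (Y i)]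
    [∀ i, FiniteDimensional k (X i)] (g : ∀ i, X i →ₗ[k] Y i) :
    Module.finrank k (LinearMap.range (LinearMap.pi fun i => g i ∘ₗ LinearMap.proj i)) =
      ∑ i, Module.finrank k (LinearMap.range (g i)) := by
  let f : (∀ i, X i) →ₗ[k] ∀ i, LinearMap.range (g i) :=
    LinearMap.pi fun i => (g i).rangeRestrict ∘ₗ LinearMap.proj i
  let j : (∀ i, LinearMap.range (g i)) →ₗ[k] ∀ i, Y i :=
    LinearMap.pi fun i => (LinearMap.range (g i)).subtype ∘ₗ LinearMap.proj i
  have hf : LinearMap.range f = ⊤ := LinearMap.range_eq_top.2 fun y => by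
    choose x hx using fun i => (g i).surjective_rangeRestrict (y i)
    exact ⟨x, funext hx⟩
  have hj : Function.Injective j := fun x y h => funext fun i => Subtype.ext (congrFun h i)
  change Module.finrank k (LinearMap.range (j ∘ₗ f)) = _
  rw [LinearMap.range_comp_of_range_eq_top j hf, LinearMap.finrank_range_of_inj hj,
    Module.finrank_pi_fintype]

variable {k : Type u} [Field k]

open Classical in
theorem finrank_range_intervalMap (J : RealInterval) (s t : ℝ) :
    Module.finrank k (LinearMap.range (intervalMap.{u, w} k J s t)) =
      if s ∈ J.carrier ∧ t ∈ J.carrier then 1 else 0 := by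
  split_ifs with h
  · have hinj : Function.Injective (intervalMap.{u, w} k J s t) := fun y y' hy =>
      Subtype.ext (by simpa only [coe_intervalMap_of_mem h.2] using congrArg Subtype.val hy)
    rw [LinearMap.finrank_range_of_inj hinj, intervalSpace, if_pos h.1, finrank_top,
      ULift.moduleEquiv.finrank_eq, Module.finrank_self]
  · have hzero : intervalMap.{u, w} k J s t = 0 := LinearMap.ext fun y => Subtype.ext <| by
      by_cases ht : t ∈ J.carrier
      · rw [coe_intervalMap_of_mem ht, coe_eq_zero_of_notMem fun hs => h ⟨hs, ht⟩]
        rfl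
      · rw [coe_eq_zero_of_notMem ht]
        rfl
    rw [hzero, LinearMap.range_zero, finrank_bot]

open Classical in
theorem finrank_range_directSum_map {n : ℕ} (J : Fin n → RealInterval) {s t : ℝ} (f : s ⟶ t) :
    Module.finrank k (LinearMap.range
      ((directSum fun i => intervalModule.{u, w} k (J i)).map f).hom) =
    (Finset.univ.filter fun i => s ∈ (J i).carrier ∧ t ∈ (J i).carrier).card := by
  rw [Finset.card_filter]
  exact (finrank_range_pi fun i => intervalMap.{u, w} k (J i) s t).trans
    (Finset.sum_congr rfl fun i _ => finrank_range_intervalMap (J i) s t)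

theorem finrank_range_map_eq {A B : PersistenceModule.{u, w} k} (α : A ≅ B) {s t : ℝ} (f : s ⟶ t) :
    Module.finrank k (LinearMap.range (A.map f).hom) =
      Module.finrank k (LinearMap.range (B.map f).hom) := by
  have hnat : (α.app t).toLinearEquiv.toLinearMap ∘ₗ (A.map f).hom =
      (B.map f).hom ∘ₗ (α.app s).toLinearEquiv.toLinearMap :=
    congrArg ModuleCat.Hom.hom (α.hom.naturality f)
  rw [← LinearMap.range_comp_of_range_eq_top (B.map f).hom (α.app s).toLinearEquiv.range, ← hnat,
    LinearMap.range_comp]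
  exact ((α.app t).toLinearEquiv.finrank_map_eq _).symm

end Ranks

section Uniqueness

/-- The pair `(inf s, sup s)`, with `sup s = ⊤` if `s` is not bounded above. -/
noncomputable def setEndpoints (s : Set ℝ) : ℝ × WithTop ℝ :=
  open Classical in (sInf s, if BddAbove s then ((sSup s : ℝ) : WithTop ℝ) else ⊤)

theorem setEndpoints_closure {s : Set ℝ} (hs : s.Nonempty) :
    setEndpoints (closure s) = setEndpoints s := by
  have hinf : sInf (closure s) = sInf s := by
    by_cases hb : BddBelow s
    · refine IsGLB.csInf_eq ?_ hs.closure
      rw [IsGLB, lowerBounds_closure]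
      exact isGLB_csInf hs hb
    · rw [Real.sInf_of_not_bddBelow hb, Real.sInf_of_not_bddBelow (mt bddBelow_closure.1 hb)]
  by_cases hb : BddAbove s
  · have hsup : sSup (closure s) = sSup s := by
      refine IsLUB.csSup_eq ?_ hs.closure
      rw [IsLUB, upperBounds_closure]
      exact isLUB_csSup hs hb
    rw [setEndpoints, setEndpoints, if_pos hb, if_pos (bddAbove_closure.2 hb), hinf, hsup]
  · rw [setEndpoints, setEndpoints, if_neg hb, if_neg (mt bddAbove_closure.1 hb), hinf]

theorem setEndpoints_interior {J : RealInterval} (hJ : (interior J.carrier).Nonempty) :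
    setEndpoints (interior J.carrier) = J.endpoints := by
  rw [← setEndpoints_closure hJ,
    (J.ordConnected.convex (𝕜 := ℝ)).closure_interior_eq_closure_of_nonempty_interior hJ,
    setEndpoints_closure J.nonempty]
  rfl

theorem endpoints_snd_eq_fst {J : RealInterval} (hJ : ¬ (interior J.carrier).Nonempty) :
    J.endpoints.2 = J.endpoints.1 := by
  rw [← (J.ordConnected.convex (𝕜 := ℝ)).nontrivial_iff_nonempty_interior,
    not_nontrivial_iff] at hJ
  obtain ⟨t, ht⟩ := J.nonempty
  have hs : J.carrier = {t} := hJ.eq_singleton_of_mem ht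
  simp [RealInterval.endpoints, hs]

theorem ofMultiset_map_filter {ι : Type*} {q : ι → Prop} [DecidablePred q] {X : Multiset ι}
    {x : ι → ℝ × WithTop ℝ} (hq : ∀ i ∈ X, ¬ q i → (x i).2 = (x i).1) :
    Bar.ofMultiset ((X.filter q).map x) = Bar.ofMultiset (X.map x) := by
  classical
  refine Subtype.ext (funext fun y => ?_)
  change withDiagonal _ y = withDiagonal _ y
  by_cases hy : y.2 = y.1
  · simp [withDiagonal, hy]
  · have hcount : ((X.filter fun i => ¬ q i).map x).count y = 0 :=
      Multiset.count_eq_zero.2 fun hmem => by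
        obtain ⟨i, hi, rfl⟩ := Multiset.mem_map.1 hmem
        exact hy (hq i (Multiset.mem_filter.1 hi).1 (Multiset.mem_filter.1 hi).2)
    nth_rw 2 [← Multiset.filter_add_not q X]
    simp [withDiagonal, hcount]

variable {ι ι' : Type*} [Fintype ι] [Fintype ι']

open Classical in
/-- The interiors of the intervals of a finite family, those with empty interior being left out:
this is what the ranks of the structure maps of the direct sum of the interval modules see. -/
noncomputable def openBars (J : ι → RealInterval) : Multiset (Set ℝ) :=
  (Finset.univ.val.map fun i => interior (J i).carrier).filter Set.Nonempty

theorem isOpen_of_mem_openBars {J : ι → RealInterval} {G : Set ℝ} (hG : G ∈ openBars J) :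
    IsOpen G := by
  classical
  obtain ⟨i, -, rfl⟩ := Multiset.mem_map.1 (Multiset.mem_of_mem_filter hG)
  exact isOpen_interior

theorem ofMultiset_map_setEndpoints_openBars (J : ι → RealInterval) :
    Bar.ofMultiset ((openBars J).map setEndpoints) =
      Bar.ofMultiset (Finset.univ.val.map fun i => (J i).endpoints) := by
  classical
  rw [openBars, Multiset.filter_map, Multiset.map_map,
    ← ofMultiset_map_filter (q := fun i => (interior (J i).carrier).Nonempty)
      fun i _ => endpoints_snd_eq_fst]
  exact congrArg _ (Multiset.map_congr rfl fun i hi =>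
    setEndpoints_interior (Multiset.mem_filter.1 hi).2)

open Classical in
theorem countP_openBars (J : ι → RealInterval) {G : Set ℝ} (hG : IsOpen G) (hne : G.Nonempty) :
    (openBars J).countP (G ≤ ·) = (Finset.univ.filter fun i => G ⊆ (J i).carrier).card := by
  rw [openBars, Multiset.countP_filter, Multiset.countP_map, Finset.card_def, Finset.filter_val]
  congr 1
  refine Multiset.filter_congr fun i _ => ?_
  rw [hG.subset_interior_iff]
  exact ⟨fun h => h.1, fun h => ⟨h, hne.mono (hG.subset_interior_iff.2 h)⟩⟩

open Classical in
theorem exists_card_filter_eq (J : ι → RealInterval) {G : Set ℝ} (hG : G.Nonempty) :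
    ∃ s ∈ G, ∃ t ∈ G, s ≤ t ∧
      (Finset.univ.filter fun i => s ∈ (J i).carrier ∧ t ∈ (J i).carrier) =
        Finset.univ.filter fun i => G ⊆ (J i).carrier := by
  obtain ⟨u, hu⟩ := hG
  have hc (i : ι) : ∃ y ∈ G, y ∈ (J i).carrier → G ⊆ (J i).carrier := by
    by_cases h : G ⊆ (J i).carrier
    · exact ⟨u, hu, fun _ => h⟩
    · obtain ⟨y, hy, hyJ⟩ := not_subset.1 h
      exact ⟨y, hy, fun h => absurd h hyJ⟩
  choose y hy hyJ using hc
  let Y : Finset ℝ := insert u (Finset.univ.image y)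
  have hY : Y.Nonempty := Finset.insert_nonempty _ _
  have hYG : ∀ z ∈ Y, z ∈ G := by
    simp only [Y, Finset.forall_mem_insert, Finset.forall_mem_image]
    exact ⟨hu, fun i _ => hy i⟩
  have hyY (i : ι) : y i ∈ Y :=
    Finset.mem_insert_of_mem (Finset.mem_image_of_mem y (Finset.mem_univ i))
  refine ⟨Y.min' hY, hYG _ (Y.min'_mem hY), Y.max' hY, hYG _ (Y.max'_mem hY), Y.min'_le_max' hY,
    Finset.filter_congr fun i _ => ⟨fun h => hyJ i ?_, fun h => ?_⟩⟩
  · exact (J i).ordConnected.out h.1 h.2 ⟨Y.min'_le _ (hyY i), Y.le_max' _ (hyY i)⟩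
  · exact ⟨h (hYG _ (Y.min'_mem hY)), h (hYG _ (Y.max'_mem hY))⟩

variable {k : Type u} [Field k]

open Classical in
theorem countP_openBars_le {n n' : ℕ} {J : Fin n → RealInterval} {J' : Fin n' → RealInterval}
    (α : (directSum fun i => intervalModule.{u, w} k (J i)) ≅
      directSum fun i => intervalModule.{u, w} k (J' i))
    {G : Set ℝ} (hG : IsOpen G) (hne : G.Nonempty) :
    (openBars J).countP (G ≤ ·) ≤ (openBars J').countP (G ≤ ·) := by
  obtain ⟨s, hs, t, ht, hst, hcard⟩ := exists_card_filter_eq J' hne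
  rw [countP_openBars J hG hne, countP_openBars J' hG hne, ← hcard,
    ← finrank_range_directSum_map.{u, w} (k := k) J' (homOfLE hst), ← finrank_range_map_eq α,
    finrank_range_directSum_map]
  exact Finset.card_le_card
    (Finset.monotone_filter_right _ fun i _ (hi : G ⊆ (J i).carrier) => ⟨hi hs, hi ht⟩)

theorem openBars_eq_of_iso {n n' : ℕ} {J : Fin n → RealInterval} {J' : Fin n' → RealInterval}
    (α : (directSum fun i => intervalModule.{u, w} k (J i)) ≅
      directSum fun i => intervalModule.{u, w} k (J' i)) :
    openBars J = openBars J' := by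
  classical
  refine multiset_eq_of_countP_le_eq fun G hG => ?_
  have hopen : IsOpen G := (Multiset.mem_add.1 hG).elim isOpen_of_mem_openBars
    isOpen_of_mem_openBars
  have hne : G.Nonempty := (Multiset.mem_add.1 hG).elim Multiset.of_mem_filter
    Multiset.of_mem_filter
  exact (countP_openBars_le α hopen hne).antisymm (countP_openBars_le α.symm hopen hne)

theorem IsDiagramOf.unique {𝕍 : PersistenceModule.{u, max u w} k} {D D' : Bar}
    (h : IsDiagramOf.{u, w} 𝕍 D) (h' : IsDiagramOf.{u, w} 𝕍 D') : D = D' := by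
  obtain ⟨n, J, -, ⟨α⟩, rfl⟩ := h
  obtain ⟨n', J', -, ⟨α'⟩, rfl⟩ := h'
  rw [← ofMultiset_map_setEndpoints_openBars, openBars_eq_of_iso (α.symm ≪≫ α'),
    ofMultiset_map_setEndpoints_openBars]

end Uniqueness

section Filtrations

variable {V : Type v} {K : PreAbstractSimplicialComplex V} {f g : K.faces → ℝ}

theorem sublevel_le (hf : IsFilterFunction f) (t : ℝ) : sublevel f hf t ≤ K :=
  fun _ hσ => hσ.1

theorem OrderingEquivalent.map_lt_map_iff (h : OrderingEquivalent f g) (a b : WithTop K.faces) :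
    a.map f < b.map f ↔ a.map g < b.map g := by
  induction a <;> induction b <;> simp [← not_le, h _ _]

theorem sublevel_eq_bot_or_exists [Finite K.faces] (h : OrderingEquivalent g f)
    (hf : IsFilterFunction f) (hg : IsFilterFunction g) (t : ℝ) :
    sublevel g hg t = ⊥ ∨ ∃ ρ, g ρ ≤ t ∧ sublevel g hg t = sublevel f hf (f ρ) := by
  by_cases ht : ∃ ρ, g ρ ≤ t
  · right
    obtain ⟨ρ, hρ, hmax⟩ := Set.exists_max_image {ρ | g ρ ≤ t} g (Set.toFinite _) ht
    refine ⟨ρ, hρ, PreAbstractSimplicialComplex.ext (Set.ext fun σ => exists_congr fun hσ => ?_)⟩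
    rw [← h]
    exact ⟨hmax ⟨σ, hσ⟩, fun hσρ => hσρ.trans hρ⟩
  · left
    exact le_bot_iff.1 fun σ ⟨hσ, hσt⟩ => (ht ⟨⟨σ, hσ⟩, hσt⟩).elim

theorem exists_entry_simplex [Finite K.faces] (hf : IsFilterFunction f)
    {P : PreAbstractSimplicialComplex V → Prop} (hP : ∀ L L', L ≤ L' → P L → P L')
    (hbot : ¬ P ⊥) :
    ∃ a : WithTop K.faces, ∀ (g : K.faces → ℝ) (hg : IsFilterFunction g),
      OrderingEquivalent g f → ∀ t, P (sublevel g hg t) ↔ a.map g ≤ t := by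
  have hsublevel {g : K.faces → ℝ} (hg : IsFilterFunction g) (hgf : OrderingEquivalent g f) {t : ℝ}
      (ht : P (sublevel g hg t)) : ∃ ρ, P (sublevel f hf (f ρ)) ∧ g ρ ≤ t := by
    obtain h0 | ⟨ρ, hρ, hρt⟩ := sublevel_eq_bot_or_exists hgf hf hg t
    · exact absurd (h0 ▸ ht) hbot
    · exact ⟨ρ, hρt ▸ ht, hρ⟩
  obtain h | ⟨σ₀, hσ₀⟩ := {σ | P (sublevel f hf (f σ))}.eq_empty_or_nonempty
  · refine ⟨⊤, fun g hg hgf t => iff_of_false (fun ht => ?_) (by simp)⟩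
    obtain ⟨ρ, hρ, -⟩ := hsublevel hg hgf ht
    exact h.subset hρ
  · obtain ⟨σ, hσ, hmin⟩ := Set.exists_min_image {σ | P (sublevel f hf (f σ))} f (Set.toFinite _)
      ⟨σ₀, hσ₀⟩
    refine ⟨σ, fun g hg hgf t => ?_⟩
    rw [WithTop.map_coe, WithTop.coe_le_coe]
    refine ⟨fun ht => ?_, fun ht => ?_⟩
    · obtain ⟨ρ, hρ, hρt⟩ := hsublevel hg hgf ht
      exact ((hgf σ ρ).2 (hmin ρ hρ)).trans hρt
    · have hle : sublevel f hf (f σ) ≤ sublevel g hg t :=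
        fun τ ⟨hτ, hτσ⟩ => ⟨hτ, ((hgf ⟨τ, hτ⟩ σ).2 hτσ).trans ht⟩
      exact hP _ _ hle hσ

end Filtrations

section Chains

variable (k : Type u) [Field k] {V : Type v} [LinearOrder V] {K : PreAbstractSimplicialComplex V}

theorem chains_bot (p : ℕ) : chains k (⊥ : PreAbstractSimplicialComplex V) p = ⊥ := by
  refine Submodule.span_eq_bot.2 ?_
  rintro _ ⟨v, -, hv, -⟩
  exact hv.elim

theorem cycles_le_chains (K : PreAbstractSimplicialComplex V) (p : ℕ) :
    cycles k K p ≤ chains k K p := by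
  cases p with
  | zero => exact le_rfl
  | succ p => exact inf_le_left

theorem cycles_bot (p : ℕ) : cycles k (⊥ : PreAbstractSimplicialComplex V) p = ⊥ :=
  le_bot_iff.1 ((cycles_le_chains k ⊥ p).trans (chains_bot k p).le)

theorem boundaries_bot (p : ℕ) : boundaries k (⊥ : PreAbstractSimplicialComplex V) p = ⊥ :=
  le_bot_iff.1 ((boundaries_le_cycles k ⊥ p).trans (cycles_bot k p).le)

theorem finiteDimensional_chains [Finite K.faces] (p : ℕ) : FiniteDimensional k (chains k K p) := by
  refine FiniteDimensional.span_of_finite k ?_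
  have hfin : {v : Fin (p + 1) → V | StrictMono v ∧ Finset.univ.image v ∈ K.faces}.Finite := by
    refine Set.Finite.of_finite_image (f := fun v => Finset.univ.image v)
      ((Set.toFinite K.faces).subset ?_) ?_
    · rintro _ ⟨v, hv, rfl⟩
      exact hv.2
    · intro v hv v' hv' h
      refine (StrictMono.range_inj hv.1 hv'.1).1 ?_
      simpa using congrArg (fun s : Finset V => (s : Set V)) h
  refine (hfin.image fun v => Finsupp.single v (1 : k)).subset ?_
  rintro _ ⟨v, hv, hvK, rfl⟩
  exact ⟨v, ⟨hv, hvK⟩, rfl⟩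

variable {f : K.faces → ℝ}

/-- The `p`-cycles of the sublevel complexes of a filter function. -/
noncomputable def sublevelCycles (hf : IsFilterFunction f) (p : ℕ) :
    ℝ →o Submodule k ((Fin (p + 1) → V) →₀ k) where
  toFun t := cycles k (sublevel f hf t) p
  monotone' _ _ h := cycles_mono k (sublevel_mono f hf h) p

/-- The `p`-boundaries of the sublevel complexes of a filter function. -/
noncomputable def sublevelBoundaries (hf : IsFilterFunction f) (p : ℕ) :
    ℝ →o Submodule k ((Fin (p + 1) → V) →₀ k) where
  toFun t := boundaries k (sublevel f hf t) p
  monotone' _ _ h := boundaries_mono k (sublevel_mono f hf h) p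

theorem persistentHomology_eq_subquotient (hf : IsFilterFunction f) (p : ℕ) :
    persistentHomology k f hf p = subquotient (sublevelCycles k hf p) (sublevelBoundaries k hf p) :=
  rfl

theorem exists_isAdapted_sublevel [Finite K.faces] (hf : IsFilterFunction f) (p : ℕ) :
    ∃ (n : ℕ) (e : Fin n → (Fin (p + 1) → V) →₀ k), LinearIndependent k e ∧
      ∀ (g : K.faces → ℝ) (hg : IsFilterFunction g), OrderingEquivalent g f → ∀ t,
        IsAdapted e (sublevelCycles k hg p t) ∧ IsAdapted e (sublevelBoundaries k hg p t) := by
  have := finiteDimensional_chains k (K := K) p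
  have hcycles (t : ℝ) : sublevelCycles k hf p t ≤ chains k K p :=
    (cycles_le_chains k _ p).trans (chains_mono k (sublevel_le hf t) p)
  obtain ⟨n, e, hli, he⟩ := exists_linearIndependent_isAdapted (H := chains k K p)
    (sublevelCycles k hf p).monotone.isChain_range
    (sublevelBoundaries k hf p).monotone.isChain_range (by
      rintro _ (⟨t, rfl⟩ | ⟨t, rfl⟩)
      exacts [hcycles t, (boundaries_le_cycles k _ p).trans (hcycles t)])
  refine ⟨n, e, hli, fun g hg hgf t => ?_⟩
  change IsAdapted e (cycles k (sublevel g hg t) p) ∧ IsAdapted e (boundaries k (sublevel g hg t) p)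
  obtain h0 | ⟨ρ, -, hρ⟩ := sublevel_eq_bot_or_exists hgf hf hg t
  · rw [h0, cycles_bot, boundaries_bot]
    exact ⟨bot_le, bot_le⟩
  · rw [hρ]
    exact ⟨he _ (Or.inl ⟨f ρ, rfl⟩), he _ (Or.inr ⟨f ρ, rfl⟩)⟩

end Chains

section Diagrams

variable {k : Type u} [Field k]

theorem endpoints_of_forall_mem_iff {J : RealInterval} {b : ℝ} {d : WithTop ℝ}
    (hJ : ∀ t : ℝ, t ∈ J.carrier ↔ b ≤ t ∧ t < d) : J.endpoints = (b, d) := by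
  induction d with
  | top =>
    have hcarrier : J.carrier = Ici b := Set.ext fun t => by simp [hJ]
    simp [RealInterval.endpoints, hcarrier, not_bddAbove_Ici]
  | coe d =>
    have hcarrier : J.carrier = Ico b d := Set.ext fun t => by simp [hJ]
    have hbd : b < d := nonempty_Ico.1 (hcarrier ▸ J.nonempty)
    simp [RealInterval.endpoints, hcarrier, csInf_Ico hbd, csSup_Ico hbd, bddAbove_Ico]

theorem isDiagramOf_subquotient {W : Type max u w} [AddCommGroup W] [Module k W]
    {Z B : ℝ →o Submodule k W} {ι : Type*} {e : ι → W} (he : LinearIndependent k e)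
    (hZ : ∀ t, IsAdapted e (Z t)) (hB : ∀ t, IsAdapted e (B t)) {b d : ι → WithTop ℝ}
    (hb : ∀ i t, e i ∈ Z t ↔ b i ≤ t) (hd : ∀ i t, e i ∈ B t ↔ d i ≤ t)
    {m : ℕ} {c : Fin m → ι} (hc : Function.Injective c) (hrange : ∀ i, i ∈ range c ↔ b i < d i)
    {β : Fin m → ℝ} (hβ : ∀ a, b (c a) = β a) :
    IsDiagramOf.{u, w} (subquotient Z B)
      (Bar.ofMultiset (Finset.univ.val.map fun a => (β a, d (c a)))) := by
  have hmem (a : Fin m) (t : ℝ) : t ∈ lifetime Z B (e (c a)) ↔ β a ≤ t ∧ t < d (c a) := by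
    rw [← WithTop.coe_le_coe, ← hβ, ← hb, ← not_le, ← hd]
    rfl
  have hne (a : Fin m) : (lifetime Z B (e (c a))).Nonempty :=
    ⟨β a, (hmem a _).2 ⟨le_rfl, hβ a ▸ (hrange _).1 ⟨a, rfl⟩⟩⟩
  have hiso : IsIso (lifetimeMap.{u, w} hne) :=
    isIso_lifetimeMap hne he hc (fun i ⟨t, htZ, htB⟩ => (hrange i).2
      (((hb i t).1 htZ).trans_lt (not_le.1 (mt (hd i t).2 htB)))) hZ hB
  refine ⟨m, fun a => lifetimeInterval (hne a), fun a => ⟨β a, fun t ht => ((hmem a t).1 ht).1⟩,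
    ⟨(asIso (lifetimeMap.{u, w} hne)).symm⟩, congrArg _ (Multiset.map_congr rfl fun a _ => ?_)⟩
  exact (endpoints_of_forall_mem_iff (hmem a)).symm

/-- The barcode whose points have as coordinates the values of `g` at the indices of the pairs in
`S`, with value `+∞` at the index `⊤`. -/
noncomputable def barcodeOfPairs {ι : Type*} (S : Multiset (ι × WithTop ι)) (g : ι → ℝ) : Bar :=
  Bar.ofMultiset (S.map (Prod.map g (WithTop.map g)))

variable {V : Type v} [LinearOrder V] {K : PreAbstractSimplicialComplex V} {f : K.faces → ℝ}

variable (k) in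
theorem exists_isDgm_barcodeOfPairs [Finite K.faces] (hf : IsFilterFunction f) (p : ℕ) :
    ∃ S : Multiset (K.faces × WithTop K.faces), ∀ (g : K.faces → ℝ) (hg : IsFilterFunction g),
      OrderingEquivalent g f → IsDgm k g hg p (barcodeOfPairs S g) := by
  classical
  obtain ⟨n, e, hli, he⟩ := exists_isAdapted_sublevel k hf p
  choose birth hbirth using fun i => exists_entry_simplex hf (P := fun L => e i ∈ cycles k L p)
    (fun _ _ h => @cycles_mono k _ _ _ _ _ h p _) (by simp [cycles_bot, hli.ne_zero i])
  choose death hdeath using fun i => exists_entry_simplex hf (P := fun L => e i ∈ boundaries k L p)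
    (fun _ _ h => @boundaries_mono k _ _ _ _ _ h p _) (by simp [boundaries_bot, hli.ne_zero i])
  let I : Finset (Fin n) := {i | (birth i).map f < (death i).map f}
  let c : Fin I.card → Fin n := I.orderEmbOfFin rfl
  have hc (i : Fin n) : i ∈ range c ↔ (birth i).map f < (death i).map f := by
    simp [c, I]
  have hσ (a : Fin I.card) : ∃ σ : K.faces, ↑σ = birth (c a) := by
    refine WithTop.ne_top_iff_exists.1 fun htop => ?_
    simpa [htop] using (hc (c a)).1 ⟨a, rfl⟩
  choose σ hσ using hσ
  refine ⟨Finset.univ.val.map fun a => (σ a, death (c a)), fun g hg hgf => ?_⟩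
  rw [barcodeOfPairs, Multiset.map_map, IsDgm, persistentHomology_eq_subquotient]
  exact isDiagramOf_subquotient hli (fun t => (he g hg hgf t).1) (fun t => (he g hg hgf t).2)
    (fun i => hbirth i g hg hgf) (fun i => hdeath i g hg hgf) (I.orderEmbOfFin rfl).injective
    (fun i => (hc i).trans (hgf.map_lt_map_iff _ _).symm)
    fun a => by rw [← hσ, WithTop.map_coe]

variable (k) in
theorem existsUnique_isDgm [Finite K.faces] (hf : IsFilterFunction f) (p : ℕ) :
    ∃! D, IsDgm k f hf p D := by
  obtain ⟨S, hS⟩ := exists_isDgm_barcodeOfPairs k hf p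
  exact existsUnique_of_exists_of_unique ⟨_, hS f hf fun _ _ => Iff.rfl⟩
    fun _ _ => IsDiagramOf.unique

theorem IsDgm.dgm_eq {hf : IsFilterFunction f} {p : ℕ} {D : Bar} (h : IsDgm k f hf p D) :
    Dgm k f hf p = D := by
  have hex : ∃ D, IsDgm k f hf p D := ⟨D, h⟩
  rw [Dgm, dif_pos hex]
  exact hex.choose_spec.unique h

end Diagrams

section Lifts

theorem exists_eq_map_univ {α : Type*} (A : Multiset α) :
    ∃ (m : ℕ) (x : Fin m → α), A = Finset.univ.val.map x := by
  induction A using Quotient.inductionOn with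
  | _ l => exact ⟨l.length, l.get, by rw [Fin.univ_val_map, List.ofFn_get]; rfl⟩

theorem exists_eq_map_add_map {α β : Type*} (S : Multiset (α × WithTop β)) :
    ∃ (A : Multiset (α × β)) (B : Multiset α),
      S = A.map (Prod.map id (↑)) + B.map (·, ⊤) := by
  induction S using Multiset.induction with
  | empty => exact ⟨0, 0, rfl⟩
  | cons s S ih =>
    obtain ⟨A, B, rfl⟩ := ih
    obtain ⟨a, b | b⟩ := s
    · exact ⟨A, a ::ₘ B, by simp; rfl⟩
    · exact ⟨(a, b) ::ₘ A, B, by simp; rfl⟩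

/-- The linear map that reads off the coordinates of an ordered barcode from the values of a
function at given indices. -/
noncomputable def readOff {ι : Type*} {m n : ℕ} (στ : Fin m → ι × ι) (ρ : Fin n → ι) :
    EuclideanSpace ℝ ι →L[ℝ] OrderedBarcode m n :=
  ((EuclideanSpace.equiv (Fin m × Fin 2) ℝ).symm.toContinuousLinearMap ∘L
    ContinuousLinearMap.pi fun q => EuclideanSpace.proj (![(στ q.1).1, (στ q.1).2] q.2)).prod
  ((EuclideanSpace.equiv (Fin n) ℝ).symm.toContinuousLinearMap ∘L
    ContinuousLinearMap.pi fun j => EuclideanSpace.proj (ρ j))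

theorem exists_quotientMap_eq_barcodeOfPairs {ι : Type*} (S : Multiset (ι × WithTop ι)) :
    ∃ (m n : ℕ) (L : EuclideanSpace ℝ ι →L[ℝ] OrderedBarcode m n),
      ∀ g, quotientMap m n (L g) = barcodeOfPairs S g := by
  obtain ⟨A, B, rfl⟩ := exists_eq_map_add_map S
  obtain ⟨m, στ, rfl⟩ := exists_eq_map_univ A
  obtain ⟨n, ρ, rfl⟩ := exists_eq_map_univ B
  refine ⟨m, n, readOff στ ρ, fun g => ?_⟩
  rw [barcodeOfPairs, Multiset.map_add, Multiset.map_map, Multiset.map_map, Multiset.map_map,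
    Multiset.map_map]
  rfl

end Lifts

section Differentiability

variable {V : Type v} {K : PreAbstractSimplicialComplex V} {M : Type*} [TopologicalSpace M]

theorem isOpen_locallyConstantOrder (F : M → K.faces → ℝ) : IsOpen (locallyConstantOrder F) := by
  refine isOpen_iff_forall_mem_open.2 ?_
  rintro x ⟨W, hW, hxW, h⟩
  exact ⟨W, fun y hy => ⟨W, hW, hy, fun z hz σ τ => (h z hz σ τ).trans (h y hy σ τ).symm⟩, hW, hxW⟩

theorem mem_locallyConstantOrder_of_forall_notMem_frontier [Finite K.faces] {F : M → K.faces → ℝ}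
    {x : M} (hx : ∀ σ τ, x ∉ frontier {y | F y σ ≤ F y τ}) : x ∈ locallyConstantOrder F := by
  have hev (σ τ : K.faces) : ∀ᶠ y in 𝓝 x, F y σ ≤ F y τ ↔ F x σ ≤ F x τ := by
    have hστ : x ∈ (frontier {y | F y σ ≤ F y τ})ᶜ := hx σ τ
    rw [compl_frontier_eq_union_interior] at hστ
    rcases hστ with h | h
    · filter_upwards [mem_interior_iff_mem_nhds.1 h] with y hy
      exact iff_of_true hy (interior_subset h :)
    · filter_upwards [mem_interior_iff_mem_nhds.1 h] with y hy
      exact iff_of_false hy (interior_subset h :)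
  obtain ⟨W, hWsub, hW, hxW⟩ := mem_nhds_iff.1
    (Filter.eventually_all.2 fun σ => Filter.eventually_all.2 (hev σ))
  exact ⟨W, hW, hxW, hWsub⟩

theorem dense_locallyConstantOrder [Finite K.faces] {F : M → K.faces → ℝ}
    (hF : ∀ σ, Continuous fun x => F x σ) : Dense (locallyConstantOrder F) := by
  let C (q : K.faces × K.faces) : Set M := (frontier {x | F x q.1 ≤ F x q.2})ᶜ
  have hopen : ∀ s ∈ range C, IsOpen s := by
    rintro _ ⟨q, rfl⟩
    exact isClosed_frontier.isOpen_compl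
  have hdense : ∀ s ∈ range C, Dense s := by
    rintro _ ⟨q, rfl⟩
    exact interior_eq_empty_iff_dense_compl.1
      (interior_frontier (isClosed_le (hF q.1) (hF q.2)))
  refine ((finite_range C).dense_sInter hopen hdense).mono fun x hx => ?_
  exact mem_locallyConstantOrder_of_forall_notMem_frontier fun σ τ =>
    mem_sInter.1 hx _ ⟨(σ, τ), rfl⟩

theorem rDifferentiableAt_dgm (k : Type u) [Field k] [LinearOrder V] [Fintype K.faces]
    {E : Type*} [NormedAddCommGroup E] [NormedSpace ℝ E] [ChartedSpace E M]
    {F : M → EuclideanSpace ℝ K.faces} (hfilter : ∀ x, IsFilterFunction (F x)) {r : ℕ∞} {U : Set M}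
    (hU : IsOpen U) (hFU : ContMDiffOn 𝓘(ℝ, E) 𝓘(ℝ, EuclideanSpace ℝ K.faces) r F U) (p : ℕ)
    {x : M} (hx : x ∈ U ∩ locallyConstantOrder fun x => F x) :
    RDifferentiableAt (E := E) r (fun y => Dgm k (F y) (hfilter y) p) x := by
  obtain ⟨hxU, W, hW, hxW, hFW⟩ := hx
  obtain ⟨S, hS⟩ := exists_isDgm_barcodeOfPairs k (hfilter x) p
  obtain ⟨m, n, L, hL⟩ := exists_quotientMap_eq_barcodeOfPairs S
  refine ⟨U ∩ W, hU.inter hW, ⟨hxU, hxW⟩, m, n, L ∘ F,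
    L.contMDiff.comp_contMDiffOn (hFU.mono inter_subset_left), fun y hy => ?_⟩
  exact (hS (F y) (hfilter y) (hFW y hy.2)).dgm_eq.trans (hL (F y)).symm

end Differentiability

end BarcodeSmoothness

theorem mainTheorem1_general (k : Type u) [Field k]
    {V : Type v} [LinearOrder V] (K : PreAbstractSimplicialComplex V) [Fintype K.faces]
    {E : Type*} [NormedAddCommGroup E] [NormedSpace ℝ E]
    {M : Type*} [TopologicalSpace M] [ChartedSpace E M]
    (F : M → EuclideanSpace ℝ K.faces)
    (hfilter : ∀ x, BarcodeSmoothness.IsFilterFunction (F x))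
    (hF : Continuous F)
    (r : ℕ∞) (U : Set M) (hU : IsOpen U)
    (hFU : ContMDiffOn 𝓘(ℝ, E) 𝓘(ℝ, EuclideanSpace ℝ K.faces) r F U)
    (p : ℕ) :
    (∀ x, ∃! D, BarcodeSmoothness.IsDgm k (F x) (hfilter x) p D) ∧
    IsOpen (BarcodeSmoothness.locallyConstantOrder fun x => F x) ∧
    Dense (BarcodeSmoothness.locallyConstantOrder fun x => F x) ∧
    (∀ x ∈ U ∩ BarcodeSmoothness.locallyConstantOrder (fun x => F x),
      BarcodeSmoothness.RDifferentiableAt (E := E) r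
        (fun y => BarcodeSmoothness.Dgm k (F y) (hfilter y) p) x) ∧
    (Dense U → ∃ G ⊆ U, IsOpen G ∧ Dense G ∧ ∀ x ∈ G,
      BarcodeSmoothness.RDifferentiableAt (E := E) r
        (fun y => BarcodeSmoothness.Dgm k (F y) (hfilter y) p) x) := by
  have hopen := BarcodeSmoothness.isOpen_locallyConstantOrder fun x => F x
  have hdense : Dense (BarcodeSmoothness.locallyConstantOrder fun x => F x) :=
    BarcodeSmoothness.dense_locallyConstantOrder fun σ => (EuclideanSpace.proj σ).continuous.comp hF
  have hdiff := fun x => BarcodeSmoothness.rDifferentiableAt_dgm k hfilter hU hFU p (x := x)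
  exact ⟨fun x => BarcodeSmoothness.existsUnique_isDgm k (hfilter x) p, hopen, hdense, hdiff,
    fun hUd => ⟨_, inter_subset_left, hU.inter hopen, hUd.inter_of_isOpen_left hdense hU, hdiff⟩⟩

theorem mainTheorem1 (k : Type u) [Field k]
    {V : Type v} [LinearOrder V] (K : PreAbstractSimplicialComplex V) [Fintype K.faces]
    {E : Type*} [NormedAddCommGroup E] [NormedSpace ℝ E] [FiniteDimensional ℝ E]
    {M : Type*} [TopologicalSpace M] [ChartedSpace E M] [IsManifold 𝓘(ℝ, E) ∞ M]
    (F : M → EuclideanSpace ℝ K.faces)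
    (hfilter : ∀ x, BarcodeSmoothness.IsFilterFunction (F x))
    (hF : Continuous F)
    (r : ℕ∞) (U : Set M) (hU : IsOpen U)
    (hFU : ContMDiffOn 𝓘(ℝ, E) 𝓘(ℝ, EuclideanSpace ℝ K.faces) r F U)
    (p : ℕ) :
    -- the persistence diagrams are well defined
    (∀ x, ∃! D, BarcodeSmoothness.IsDgm k (F x) (hfilter x) p D) ∧
    IsOpen (BarcodeSmoothness.locallyConstantOrder fun x => F x) ∧
    Dense (BarcodeSmoothness.locallyConstantOrder fun x => F x) ∧
    (∀ x ∈ U ∩ BarcodeSmoothness.locallyConstantOrder (fun x => F x),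
      BarcodeSmoothness.RDifferentiableAt (E := E) r
        (fun y => BarcodeSmoothness.Dgm k (F y) (hfilter y) p) x) ∧
    (Dense U → ∃ G ⊆ U, IsOpen G ∧ Dense G ∧ ∀ x ∈ G,
      BarcodeSmoothness.RDifferentiableAt (E := E) r
        (fun y => BarcodeSmoothness.Dgm k (F y) (hfilter y) p) x) :=
  mainTheorem1_general k K F hfilter hF r U hU hFU p
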